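/- Let $R$ be a commutative Noetherian ring with non-zero identity, let $I$ be a proper ideal of $R$, and let $C$ be a semidualizing $R$-module, i.e. a finitely generated $R$-module such that the homothety map $R\to\operatorname{Hom}_R(C,C)$ is an isomorphism and $\operatorname{Ext}^i_R(C,C)=0$ for all $i>0$. For $R$-modules $M,N$ and $i\ge 0$ put $H^i_I(M,N)=\varinjlim_q \operatorname{Ext}^i_R(M/I^qM,N)$, $\operatorname{depth}_I(M,N)=\inf\{i\ge 0\mid H^i_I(M,N)\ne 0\}$ and $\operatorname{cd}_I(M,N)=\sup\{i\ge 0\mid H^i_I(M,N)\neq 0\}$ (with $\inf\emptyset=\infty$, $\sup\emptyset=-\infty$), and write $\operatorname{depth}_I N=\operatorname{depth}_I(R,N)$, $\operatorname{cd}_I N=\operatorname{cd}_I(R,N)$; note that $H^i_I(R,N)=H^i_I(N)$ is ordinary local cohomology. The pair $M,N$ is called a Cohen–Macaulay pair with respect to $I$ if $\operatorname{depth}_I(M,N)=\operatorname{cd}_I(M,N)$, and $N$ is called Cohen–Macaulay with respect to $I$ if $\operatorname{depth}_I N=\operatorname{cd}_I N$. The ideal $I$ is called a cohomologically complete intersection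 if $\operatorname{grade} I=\operatorname{cd}_I R$, where $\operatorname{grade} I$ is the supremum of the lengths of the $R$-regular sequences contained in $I$. Then $$\operatorname{depth}_I(C,C)=\operatorname{depth}_I R\quad\text{and}\quad \operatorname{cd}_I(C,C)=\operatorname{cd}_I R.$$ Moreover, $R$ is Cohen–Macaulay with respect to $I$ if and only if $C,C$ is a Cohen–Macaulay pair with respect to $I$; and likewise $I$ is a cohomologically complete intersection if and only if $C,C$ is a Cohen–Macaulay pair with respect to $I$. -/

import Mathlib

universe u

namespace RelCM

noncomputable section

variable {R : Type u} [CommRing R]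

/-- The natural surjection `M / I ^ b M → M / I ^ a M` for `a ≤ b`. -/
def powQuotMap (I : Ideal R) (M : Type u) [AddCommGroup M] [Module R M] {a b : ℕ} (h : a ≤ b) :
    (M ⧸ (I ^ b • ⊤ : Submodule R M)) →ₗ[R] (M ⧸ (I ^ a • ⊤ : Submodule R M)) :=
  Submodule.factor (Submodule.smul_mono_left (Ideal.pow_le_pow_right h))

/-- The `R`-module `Ext_R^i(M, N)`. -/
abbrev ExtMod (R : Type u) [CommRing R] (i : ℕ) (M N : Type u) [AddCommGroup M] [Module R M]
    [AddCommGroup N] [Module R N] : Type u :=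
  CategoryTheory.Abelian.Ext.{u} (ModuleCat.of R M) (ModuleCat.of R N) i

/-- The `R`-linear map `Ext_R^i(M', N) → Ext_R^i(M, N)` induced by an `R`-linear map `M → M'`. -/
def extPrecomp (i : ℕ) {M M' : Type u} (N : Type u) [AddCommGroup M] [Module R M]
    [AddCommGroup M'] [Module R M'] [AddCommGroup N] [Module R N] (f : M →ₗ[R] M') :
    ExtMod R i M' N →ₗ[R] ExtMod R i M N :=
  (CategoryTheory.Abelian.Ext.mk₀ (ModuleCat.ofHom f)).precompOfLinear R (ModuleCat.of R N)
    (zero_add i)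

/-- The transition map `Ext_R^i(M / I ^ a M, N) → Ext_R^i(M / I ^ b M, N)` for `a ≤ b`. -/
def extTransition (I : Ideal R) (i : ℕ) (M N : Type u) [AddCommGroup M] [Module R M]
    [AddCommGroup N] [Module R N] (a b : ℕ) (h : a ≤ b) :
    ExtMod R i (M ⧸ (I ^ a • ⊤ : Submodule R M)) N →ₗ[R]
      ExtMod R i (M ⧸ (I ^ b • ⊤ : Submodule R M)) N :=
  extPrecomp i N (powQuotMap I M h)

/-- The generalized local cohomology module
`H_I^i(M, N) = lim_q Ext_R^i(M / I ^ q M, N)` (direct limit). -/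
abbrev GenLocalCohomology (I : Ideal R) (i : ℕ) (M N : Type u) [AddCommGroup M] [Module R M]
    [AddCommGroup N] [Module R N] : Type u :=
  Module.DirectLimit (fun q : ℕ => ExtMod R i (M ⧸ (I ^ q • ⊤ : Submodule R M)) N)
    (extTransition I i M N)

/-- The transition maps do form a directed system. -/
instance directedSystem_extTransition (I : Ideal R) (i : ℕ) (M N : Type u) [AddCommGroup M]
    [Module R M] [AddCommGroup N] [Module R N] :
    DirectedSystem (fun q : ℕ => ExtMod R i (M ⧸ (I ^ q • ⊤ : Submodule R M)) N)
      (fun a b h => extTransition I i M N a b h) where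
  map_self a x := by
    have : powQuotMap I M (le_refl a) = LinearMap.id := by
      ext x; rfl
    simp [extTransition, extPrecomp, this]
  map_map a b c hab hbc x := by
    have : powQuotMap I M (hab.trans hbc) = powQuotMap I M hab ∘ₗ powQuotMap I M hbc := by
      ext x; rfl
    simp only [extTransition, extPrecomp, this, ModuleCat.ofHom_comp,
      CategoryTheory.Abelian.Ext.bilinearCompOfLinear_apply_apply]
    rw [CategoryTheory.Abelian.Ext.mk₀_comp_mk₀_assoc]

/-- `depth_I(M, N) = inf {i ≥ 0 | H_I^i(M, N) ≠ 0}`, with the convention `inf ∅ = ∞`. -/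
def depthPair (I : Ideal R) (M N : Type u) [AddCommGroup M] [Module R M]
    [AddCommGroup N] [Module R N] : WithBot ℕ∞ :=
  ⨅ (i : ℕ) (_ : Nontrivial (GenLocalCohomology I i M N)), ((i : ℕ∞) : WithBot ℕ∞)

/-- `cd_I(M, N) = sup {i ≥ 0 | H_I^i(M, N) ≠ 0}`, with the convention `sup ∅ = -∞`;
the value is `∞` if infinitely many of these modules are non-zero. -/
def cdPair (I : Ideal R) (M N : Type u) [AddCommGroup M] [Module R M]
    [AddCommGroup N] [Module R N] : WithBot ℕ∞ :=
  ⨆ (i : ℕ) (_ : Nontrivial (GenLocalCohomology I i M N)), ((i : ℕ∞) : WithBot ℕ∞)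

/-- `depth_I N = inf {i ≥ 0 | H_I^i(N) ≠ 0}`, where
`H_I^i(N) = H_I^i(R, N) = lim_q Ext_R^i(R / I ^ q, N)` is ordinary local cohomology. -/
def depth (I : Ideal R) (N : Type u) [AddCommGroup N] [Module R N] : WithBot ℕ∞ :=
  depthPair I R N

/-- `cd_I N = sup {i ≥ 0 | H_I^i(N) ≠ 0}`, where
`H_I^i(N) = H_I^i(R, N) = lim_q Ext_R^i(R / I ^ q, N)` is ordinary local cohomology. -/
def cd (I : Ideal R) (N : Type u) [AddCommGroup N] [Module R N] : WithBot ℕ∞ :=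
  cdPair I R N

/-- `M, N` is a Cohen-Macaulay pair with respect to `I`. -/
def IsCMPair (I : Ideal R) (M N : Type u) [AddCommGroup M] [Module R M]
    [AddCommGroup N] [Module R N] : Prop :=
  depthPair I M N = cdPair I M N

/-- `N` is (relative) Cohen-Macaulay with respect to `I`. -/
def IsRelCM (I : Ideal R) (N : Type u) [AddCommGroup N] [Module R N] : Prop :=
  depth I N = cd I N

/-- The grade of an ideal: the supremum of the lengths of the `R`-regular sequences with all
members in `I`. -/
def grade (I : Ideal R) : ℕ∞ :=
  ⨆ (rs : List R) (_ : (∀ r ∈ rs, r ∈ I) ∧ RingTheory.Sequence.IsRegular R rs),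
    (rs.length : ℕ∞)

/-- `I` is a cohomologically complete intersection: `grade I = cd_I R`. -/
def IsCohomologicallyCI (I : Ideal R) : Prop :=
  (grade I : WithBot ℕ∞) = cd I R

/-- A semidualizing module: a finitely generated module `C` such that the homothety map
`R → Hom_R(C, C)` is an isomorphism and `Ext_R^i(C, C) = 0` for all `i > 0`. -/
structure IsSemidualizing (R : Type u) [CommRing R] (C : Type u) [AddCommGroup C]
    [Module R C] : Prop where
  finite : Module.Finite R C
  homothety_bijective : Function.Bijective (LinearMap.lsmul R C)
  ext_eq_zero : ∀ i : ℕ, 0 < i → Subsingleton (ExtMod R i C C)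

end

end RelCM

namespace RelCM

open CategoryTheory Abelian

variable {R : Type u} [CommRing R]

/-! Depth and cohomological dimension depend only on the degrees in which `H_I^i` vanishes, so it
suffices that `H_I^i(C, C)` and `H_I^i(R)` vanish for the same `i`; no isomorphism between them is
built. For finite `M` with `Ext^j(M, K) = 0` for all `j > 0`, `H_I^i(M, K)` and `H_I^i(Hom(M, K))`
vanish together (`extEventuallyZero_iff_hom`). Embed `K` in an injective `J`. `Hom(M, -)` keeps the
sequence with cokernel `J / K` exact, and `Hom(M, J)` is acyclic for local cohomology by Artin-Rees
(`extEventuallyZero_hom_injective`). Dimension shifting on both sides then leads down to degrees 0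
and 1, which are questions about `I`-power torsion maps. Taking `M = K = C` and `Hom(C, C) ≅ R`
gives the comparison. The last equivalence also needs `grade I = depth_I R` (`grade_eq_depth`), from
the Ext criterion for regular sequences. -/

/-- The surjection `M / I ^ b M → M / I ^ a M` as a morphism of `ModuleCat R`. -/
def powQuotHom (I : Ideal R) (M : Type u) [AddCommGroup M] [Module R M] {a b : ℕ} (h : a ≤ b) :
    ModuleCat.of R (M ⧸ (I ^ b • ⊤ : Submodule R M)) ⟶
      ModuleCat.of R (M ⧸ (I ^ a • ⊤ : Submodule R M)) :=
  ModuleCat.ofHom (powQuotMap I M h)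

lemma powQuotHom_comp (I : Ideal R) (M : Type u) [AddCommGroup M] [Module R M] {a b c : ℕ}
    (hab : a ≤ b) (hbc : b ≤ c) :
    powQuotHom I M hbc ≫ powQuotHom I M hab = powQuotHom I M (hab.trans hbc) := by
  ext x; rfl

/-- The direct system `Ext^i(M / I ^ q M, N)` has zero limit: every element dies at a later
stage. -/
def ExtEventuallyZero (I : Ideal R) (i : ℕ) (M : Type u) [AddCommGroup M] [Module R M]
    (N : ModuleCat.{u} R) : Prop :=
  ∀ (q : ℕ) (x : Ext (ModuleCat.of R (M ⧸ (I ^ q • ⊤ : Submodule R M))) N i),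
    ∃ (q' : ℕ) (h : q ≤ q'), (Ext.mk₀ (powQuotHom I M h)).comp x (zero_add i) = 0

lemma subsingleton_genLocalCohomology_iff (I : Ideal R) (i : ℕ) (M N : Type u) [AddCommGroup M]
    [Module R M] [AddCommGroup N] [Module R N] :
    Subsingleton (GenLocalCohomology I i M N) ↔ ExtEventuallyZero I i M (ModuleCat.of R N) := by
  constructor
  · intro h q x
    obtain ⟨q', h', hx⟩ := Module.DirectLimit.of.zero_exact (R := R)
      (f := extTransition I i M N) (i := q) (x := x) (Subsingleton.elim _ _)
    exact ⟨q', h', hx⟩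
  · intro h
    refine subsingleton_of_forall_eq 0 fun z => ?_
    obtain ⟨q, x, rfl⟩ := Module.DirectLimit.exists_of z
    obtain ⟨q', h', hx⟩ := h q x
    rw [← Module.DirectLimit.of_f (hij := h')]
    exact (congrArg _ hx).trans (map_zero _)

lemma nontrivial_genLocalCohomology_iff (I : Ideal R) (i : ℕ) (M N : Type u) [AddCommGroup M]
    [Module R M] [AddCommGroup N] [Module R N] :
    Nontrivial (GenLocalCohomology I i M N) ↔ ¬ ExtEventuallyZero I i M (ModuleCat.of R N) := by
  rw [← subsingleton_genLocalCohomology_iff, not_subsingleton_iff_nontrivial]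

/-! ### Dimension shifting for the limit of Ext -/

section

variable {I : Ideal R} {i : ℕ} {M : Type u} [AddCommGroup M] [Module R M]

lemma ExtEventuallyZero.of_forall_subsingleton {N : ModuleCat.{u} R}
    (h : ∀ q, Subsingleton (Ext (ModuleCat.of R (M ⧸ (I ^ q • ⊤ : Submodule R M))) N i)) :
    ExtEventuallyZero I i M N :=
  fun q _ => ⟨q, le_rfl, by have := h q; rw [Subsingleton.elim (Ext.comp _ _ _) 0]⟩

lemma extEventuallyZero_of_injective (N : ModuleCat.{u} R) [Injective N] :
    ExtEventuallyZero I (i + 1) M N :=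
  .of_forall_subsingleton fun _ => Ext.subsingleton_of_injective _ _ _

lemma ExtEventuallyZero.of_iso {N N' : ModuleCat.{u} R} (e : N ≅ N')
    (h : ExtEventuallyZero I i M N) : ExtEventuallyZero I i M N' := by
  intro q x
  obtain ⟨q', h', hx⟩ := h q (x.comp (Ext.mk₀ e.inv) (add_zero i))
  refine ⟨q', h', ?_⟩
  have := congrArg (fun z => Ext.comp z (Ext.mk₀ e.hom) (add_zero i)) hx
  simpa [Ext.comp_assoc_of_third_deg_zero] using this

variable {S : ShortComplex (ModuleCat.{u} R)} (hS : S.ShortExact)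
include hS

/-- The transition maps act on the first variable, so they commute with the covariant long exact
sequence. The usual chase works after passing to a later stage twice. -/
lemma ExtEventuallyZero.right (h₂ : ExtEventuallyZero I i M S.X₂)
    (h₁ : ExtEventuallyZero I (i + 1) M S.X₁) : ExtEventuallyZero I i M S.X₃ := by
  intro q x
  obtain ⟨a, ha, hxa⟩ := h₁ q (x.comp hS.extClass rfl)
  rw [← Ext.comp_assoc _ _ _ (zero_add i) rfl (by omega)] at hxa
  obtain ⟨y, hy⟩ := Ext.covariant_sequence_exact₃ _ hS _ rfl hxa
  obtain ⟨b, hb, hyb⟩ := h₂ a y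
  refine ⟨b, ha.trans hb, ?_⟩
  rw [← powQuotHom_comp I M ha hb, ← Ext.mk₀_comp_mk₀_assoc, ← hy,
    ← Ext.comp_assoc_of_third_deg_zero, hyb, Ext.zero_comp]

lemma ExtEventuallyZero.left (h₃ : ExtEventuallyZero I i M S.X₃)
    (h₂ : ExtEventuallyZero I (i + 1) M S.X₂) : ExtEventuallyZero I (i + 1) M S.X₁ := by
  intro q x
  obtain ⟨a, ha, hxa⟩ := h₂ q (x.comp (Ext.mk₀ S.f) (add_zero _))
  rw [← Ext.comp_assoc_of_third_deg_zero] at hxa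
  obtain ⟨y, hy⟩ := Ext.covariant_sequence_exact₁ _ hS _ hxa rfl
  obtain ⟨b, hb, hyb⟩ := h₃ a y
  refine ⟨b, ha.trans hb, ?_⟩
  rw [← powQuotHom_comp I M ha hb, ← Ext.mk₀_comp_mk₀_assoc, ← hy,
    ← Ext.comp_assoc _ _ _ (zero_add i) rfl (by omega), hyb, Ext.zero_comp]

lemma extEventuallyZero_left_iff (h₂ : ExtEventuallyZero I i M S.X₂)
    (h₂' : ExtEventuallyZero I (i + 1) M S.X₂) :
    ExtEventuallyZero I (i + 1) M S.X₁ ↔ ExtEventuallyZero I i M S.X₃ :=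
  ⟨fun h => h₂.right hS h, fun h => h.left hS h₂'⟩

end

/-! ### Degrees 0 and 1 through `I`-power torsion maps -/

section

variable (I : Ideal R)

/-- `x` is annihilated by some power of `I`. -/
def IsPowTorsion {X : Type*} [AddCommGroup X] [Module R X] (x : X) : Prop :=
  ∃ q : ℕ, ∀ r ∈ I ^ q, r • x = 0

variable {I}

lemma isPowTorsion_equiv_iff {X Y : Type*} [AddCommGroup X] [Module R X] [AddCommGroup Y]
    [Module R Y] (e : X ≃ₗ[R] Y) {x : X} : IsPowTorsion I (e x) ↔ IsPowTorsion I x := by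
  simp [IsPowTorsion, ← map_smul]

lemma isPowTorsion_comp_mkQ {M N : Type*} [AddCommGroup M] [Module R M] [AddCommGroup N]
    [Module R N] {q : ℕ} (g : (M ⧸ (I ^ q • ⊤ : Submodule R M)) →ₗ[R] N) :
    IsPowTorsion I (g ∘ₗ Submodule.mkQ _) := by
  refine ⟨q, fun r hr => ?_⟩
  ext m
  have : (I ^ q • ⊤ : Submodule R M).mkQ (r • m) = 0 :=
    (Submodule.Quotient.mk_eq_zero _).2 (Submodule.smul_mem_smul hr Submodule.mem_top)
  simp only [LinearMap.smul_apply, LinearMap.comp_apply, LinearMap.zero_apply]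
  rw [← map_smul, ← map_smul, this, map_zero]

lemma pow_smul_top_le_ker {M N : Type*} [AddCommGroup M] [Module R M] [AddCommGroup N]
    [Module R N] {f : M →ₗ[R] N} {q q' : ℕ} (h : ∀ r ∈ I ^ q, r • f = 0) (hq : q ≤ q') :
    (I ^ q' • ⊤ : Submodule R M) ≤ LinearMap.ker f := by
  refine Submodule.smul_le.2 fun r hr m _ => ?_
  simpa using LinearMap.congr_fun (h r (Ideal.pow_le_pow_right hq hr)) m

variable (I) in
/-- Homomorphisms out of `M` that are annihilated by a power of `I` lift along `π` to
homomorphisms with the same property. -/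
def TorsionLifts (M : Type*) [AddCommGroup M] [Module R M] {E N : Type*} [AddCommGroup E]
    [Module R E] [AddCommGroup N] [Module R N] (π : E →ₗ[R] N) : Prop :=
  ∀ f : M →ₗ[R] N, IsPowTorsion I f → ∃ g : M →ₗ[R] E, π ∘ₗ g = f ∧ IsPowTorsion I g

/-- Both sides agree under `Hom(R, Hom(M, -)) ≅ Hom(M, -)`. This carries the degree 1 criterion from
the pair `(M, K)` to `(R, Hom(M, K))`. -/
lemma torsionLifts_iff_compRight (M : Type*) [AddCommGroup M] [Module R M] {E N : Type*}
    [AddCommGroup E] [Module R E] [AddCommGroup N] [Module R N] (π : E →ₗ[R] N) :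
    TorsionLifts I M π ↔ TorsionLifts I R (LinearMap.compRight R π (M := M)) := by
  let eE := (LinearMap.ringLmapEquivSelf R R (M →ₗ[R] E))
  let eN := (LinearMap.ringLmapEquivSelf R R (M →ₗ[R] N))
  constructor
  · intro h f hf
    obtain ⟨g, hg, hgt⟩ := h (eN f) ((isPowTorsion_equiv_iff eN).2 hf)
    refine ⟨eE.symm g, ?_, (isPowTorsion_equiv_iff _).2 hgt⟩
    ext1
    simpa [eE, eN] using hg
  · intro h f hf
    obtain ⟨g, hg, hgt⟩ := h (eN.symm f) ((isPowTorsion_equiv_iff _).2 hf)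
    refine ⟨eE g, ?_, (isPowTorsion_equiv_iff _).2 hgt⟩
    simpa [eE, eN] using LinearMap.congr_fun hg 1

variable {M : Type u} [AddCommGroup M] [Module R M]

/-- A map out of `M` is `I`-power torsion exactly when it factors through some `M / I ^ q M`, so the
limit in degree 0 consists of these maps. -/
lemma extEventuallyZero_zero_iff (N : ModuleCat.{u} R) :
    ExtEventuallyZero I 0 M N ↔ ∀ f : M →ₗ[R] N, IsPowTorsion I f → f = 0 := by
  constructor
  · rintro h f ⟨q, hq⟩
    obtain ⟨q', h', hx⟩ := h q
      (Ext.mk₀ (ModuleCat.ofHom (Submodule.liftQ _ f (pow_smul_top_le_ker hq le_rfl))))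
    rw [Ext.mk₀_comp_mk₀, Ext.mk₀_eq_zero_iff] at hx
    ext m
    exact congrArg (fun z => z.hom (Submodule.Quotient.mk m)) hx
  · intro h q x
    obtain ⟨x, rfl⟩ := (Ext.mk₀_bijective _ _).2 x
    refine ⟨q, le_rfl, ?_⟩
    have : x = 0 := by
      ext m
      exact LinearMap.congr_fun (h _ (isPowTorsion_comp_mkQ x.hom)) m
    rw [this, Ext.mk₀_zero, Ext.comp_zero]

/-- When the middle term has no `H^1`, the `H^1` of the left term is the cokernel of the map on
`I`-power torsion homomorphisms induced by `S.g`. -/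
lemma extEventuallyZero_one_iff {S : ShortComplex (ModuleCat.{u} R)} (hS : S.ShortExact)
    (h₂ : ExtEventuallyZero I 1 M S.X₂) :
    ExtEventuallyZero I 1 M S.X₁ ↔ TorsionLifts I M S.g.hom := by
  constructor
  · rintro h f ⟨q, hq⟩
    obtain ⟨q', h', hx⟩ := h q ((Ext.mk₀ (ModuleCat.ofHom (Submodule.liftQ _ f
      (pow_smul_top_le_ker hq le_rfl)))).comp hS.extClass (zero_add 1))
    rw [Ext.mk₀_comp_mk₀_assoc] at hx
    obtain ⟨y, hy⟩ := Ext.covariant_sequence_exact₃ _ hS _ (zero_add 1) hx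
    obtain ⟨y, rfl⟩ := (Ext.mk₀_bijective _ _).2 y
    rw [Ext.mk₀_comp_mk₀] at hy
    replace hy := (Ext.mk₀_bijective _ _).1 hy
    refine ⟨y.hom ∘ₗ Submodule.mkQ _, ?_, isPowTorsion_comp_mkQ y.hom⟩
    ext m
    exact congrArg (fun z => z.hom (Submodule.Quotient.mk m)) hy
  · intro h q x
    obtain ⟨a, ha, hxa⟩ := h₂ q (x.comp (Ext.mk₀ S.f) (add_zero _))
    rw [← Ext.comp_assoc_of_third_deg_zero] at hxa
    obtain ⟨z, hz⟩ := Ext.covariant_sequence_exact₁ _ hS _ hxa (zero_add 1)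
    obtain ⟨z, rfl⟩ := (Ext.mk₀_bijective _ _).2 z
    obtain ⟨g, hg, b, hb⟩ := h _ (isPowTorsion_comp_mkQ z.hom)
    refine ⟨max a b, ha.trans (le_max_left a b), ?_⟩
    let g' : ModuleCat.of R (M ⧸ (I ^ max a b • ⊤ : Submodule R M)) ⟶ S.X₂ :=
      ModuleCat.ofHom (Submodule.liftQ _ g (pow_smul_top_le_ker hb (le_max_right a b)))
    have hg' : powQuotHom I M (le_max_left a b) ≫ z = g' ≫ S.g := by
      ext m
      exact (LinearMap.congr_fun hg m).symm
    rw [← powQuotHom_comp I M ha (le_max_left a b), ← Ext.mk₀_comp_mk₀_assoc, ← hz,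
      Ext.mk₀_comp_mk₀_assoc, hg', ← Ext.mk₀_comp_mk₀_assoc, hS.comp_extClass, Ext.comp_zero]

end

/-! ### Acyclicity of `Hom(M, J)` and comparison with `Hom(M, K)` -/

section

variable {I : Ideal R}

/-- The complex `Hom(M, S)` for a short complex `S`. -/
noncomputable def homShortComplex (M : Type u) [AddCommGroup M] [Module R M]
    (S : ShortComplex (ModuleCat.{u} R)) : ShortComplex (ModuleCat.{u} R) :=
  ShortComplex.moduleCatMk (LinearMap.compRight R S.f.hom (M := M))
    (LinearMap.compRight R S.g.hom (M := M)) (by ext; simp)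

lemma homShortComplex_shortExact {M : Type u} [AddCommGroup M] [Module R M]
    {S : ShortComplex (ModuleCat.{u} R)} (hS : S.ShortExact)
    (h : Subsingleton (Ext (ModuleCat.of R M) S.X₁ 1)) : (homShortComplex M S).ShortExact where
  exact := by
    refine ((homShortComplex M S).moduleCat_exact_iff).2 fun f hf => ?_
    have := hS.mono_f
    have hf' : ModuleCat.ofHom (X := M) f ≫ S.g = 0 := by
      ext m
      exact LinearMap.congr_fun hf m
    refine ⟨(hS.exact.lift _ hf').hom, LinearMap.ext fun m => ?_⟩
    exact congrArg (fun z => z.hom m) (hS.exact.lift_f _ hf')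
  mono_f := by
    refine (ModuleCat.mono_iff_injective _).2 fun f g hfg => LinearMap.ext fun m => ?_
    exact hS.moduleCat_injective_f (LinearMap.congr_fun hfg m)
  epi_g := by
    refine (ModuleCat.epi_iff_surjective _).2 fun f => ?_
    obtain ⟨y, hy⟩ := Ext.covariant_sequence_exact₃ (ModuleCat.of R M) hS
      (Ext.mk₀ (ModuleCat.ofHom f)) (zero_add 1) (Subsingleton.elim _ _)
    obtain ⟨y, rfl⟩ := (Ext.mk₀_bijective _ _).2 y
    rw [Ext.mk₀_comp_mk₀] at hy
    refine ⟨y.hom, ?_⟩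
    exact congrArg ModuleCat.Hom.hom ((Ext.mk₀_bijective _ _).1 hy)

/-- The complex `Hom(M, J) → Hom(P, J) → Hom(ker p, J)` attached to `p : P → M`. -/
noncomputable def homKerShortComplex {P M : Type u} [AddCommGroup P] [Module R P] [AddCommGroup M]
    [Module R M] (p : P →ₗ[R] M) (J : Type u) [AddCommGroup J] [Module R J] :
    ShortComplex (ModuleCat.{u} R) :=
  ShortComplex.moduleCatMk (LinearMap.lcomp R J p)
    (LinearMap.lcomp R J (LinearMap.ker p).subtype) (by ext; simp)

lemma homKerShortComplex_shortExact {P M : Type u} [AddCommGroup P] [Module R P] [AddCommGroup M]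
    [Module R M] {p : P →ₗ[R] M} (hp : Function.Surjective p) (J : Type u) [AddCommGroup J]
    [Module R J] [Module.Injective R J] : (homKerShortComplex p J).ShortExact where
  exact := by
    refine ((homKerShortComplex p J).moduleCat_exact_iff).2 fun f hf => ?_
    have hker : LinearMap.ker p ≤ LinearMap.ker f := fun x hx =>
      LinearMap.congr_fun hf ⟨x, hx⟩
    refine ⟨(LinearMap.ker p).liftQ f hker ∘ₗ (p.quotKerEquivOfSurjective hp).symm.toLinearMap,
      LinearMap.ext fun x => ?_⟩
    change (LinearMap.ker p).liftQ f hker ((p.quotKerEquivOfSurjective hp).symm (p x)) =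
      DFunLike.coe (F := P →ₗ[R] J) f x
    rw [← p.quotKerEquivOfSurjective_apply_mk hp, LinearEquiv.symm_apply_apply]
    rfl
  mono_f := by
    refine (ModuleCat.mono_iff_injective _).2 fun f g hfg => LinearMap.ext fun m => ?_
    obtain ⟨x, rfl⟩ := hp m
    exact LinearMap.congr_fun hfg x
  epi_g := (ModuleCat.epi_iff_surjective _).2 fun f =>
    Module.Injective.extension_property R J _ _ (LinearMap.ker p).subtype
      (Submodule.subtype_injective _) f

/-- By the Artin-Rees lemma, `I`-power torsion maps from a submodule to an injective module
extend to `I`-power torsion maps. -/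
lemma IsPowTorsion.exists_extension [IsNoetherianRing R] {P : Type u} [AddCommGroup P] [Module R P]
    [Module.Finite R P] (K : Submodule R P) {J : Type u} [AddCommGroup J] [Module R J]
    [Module.Injective R J] {f : K →ₗ[R] J} (hf : IsPowTorsion I f) :
    ∃ g : P →ₗ[R] J, g ∘ₗ K.subtype = f ∧ IsPowTorsion I g := by
  obtain ⟨q, hq⟩ := hf
  -- Artin-Rees: `I ^ (q + k) P ∩ K = I ^ q (I ^ k P ∩ K)`, which `f` kills. So `f` factors through
  -- the image of `K` in `P / I ^ (q + k) P`, and injectivity of `J` extends it to that quotient.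
  obtain ⟨k, hk⟩ := I.exists_pow_inf_eq_pow_smul K
  let φ : K →ₗ[R] P ⧸ (I ^ (q + k) • ⊤ : Submodule R P) := Submodule.mkQ _ ∘ₗ K.subtype
  have hφ : LinearMap.ker φ ≤ LinearMap.ker f := by
    intro x hx
    have hx' : (x : P) ∈ (I ^ (q + k) • ⊤ : Submodule R P) ⊓ K :=
      ⟨(Submodule.Quotient.mk_eq_zero _).1 hx, x.2⟩
    rw [hk _ (Nat.le_add_left k q), Nat.add_sub_cancel] at hx'
    have hle : I ^ q • (I ^ k • ⊤ ⊓ K) ≤ (LinearMap.ker f).map K.subtype := by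
      refine Submodule.smul_le.2 fun r hr m hm => ?_
      exact ⟨r • ⟨m, hm.2⟩, (map_smul f r _).trans (LinearMap.congr_fun (hq r hr) _), rfl⟩
    obtain ⟨y, hy, hyx⟩ := hle hx'
    rwa [← Subtype.ext hyx]
  obtain ⟨h, hh⟩ := Module.Injective.extension_property R J _ _
    ((LinearMap.ker φ).liftQ φ le_rfl)
    (LinearMap.ker_eq_bot.1 (Submodule.ker_liftQ_eq_bot _ _ _ le_rfl)) ((LinearMap.ker φ).liftQ f hφ)
  refine ⟨h ∘ₗ Submodule.mkQ _, ?_, isPowTorsion_comp_mkQ h⟩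
  ext x
  exact LinearMap.congr_fun hh (Submodule.Quotient.mk x)

lemma torsionLifts_homKerShortComplex_g [IsNoetherianRing R] {P M : Type u} [AddCommGroup P]
    [Module R P] [Module.Finite R P] [AddCommGroup M] [Module R M] (p : P →ₗ[R] M) (J : Type u)
    [AddCommGroup J] [Module R J] [Module.Injective R J] :
    TorsionLifts I R (homKerShortComplex p J).g.hom := by
  intro f hf
  obtain ⟨g, hg, hgt⟩ := ((isPowTorsion_equiv_iff
    (LinearMap.ringLmapEquivSelf R R (LinearMap.ker p →ₗ[R] J))).2 hf).exists_extension
  refine ⟨(LinearMap.ringLmapEquivSelf R R (P →ₗ[R] J)).symm g, ?_,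
    (isPowTorsion_equiv_iff _).2 hgt⟩
  refine LinearMap.ext_ring ?_
  change g ∘ₗ (LinearMap.ker p).subtype = _ at hg
  refine Eq.trans ?_ hg
  change ((1 : R) • g) ∘ₗ (LinearMap.ker p).subtype = _
  rw [one_smul]

lemma injective_of_linearEquiv {X Y : Type u} [AddCommGroup X] [Module R X] [AddCommGroup Y]
    [Module R Y] (e : X ≃ₗ[R] Y) [Module.Injective R X] : Injective (ModuleCat.of R Y) :=
  have := Module.injective_object_of_injective_module R X
  Injective.of_iso e.toModuleIso this

/-- `Hom(M, J)` is acyclic for local cohomology if `M` is finite and `J` is injective. -/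
lemma extEventuallyZero_hom_injective [IsNoetherianRing R] (J : Type u) [AddCommGroup J]
    [Module R J] [Module.Injective R J] (n : ℕ) (M : Type u) [AddCommGroup M] [Module R M]
    [Module.Finite R M] :
    ExtEventuallyZero I (n + 1) R (ModuleCat.of R (M →ₗ[R] J)) := by
  induction n generalizing M with
  | zero =>
    obtain ⟨k, p, hp⟩ := Module.Finite.exists_fin' R M
    -- The middle term is `Hom(R ^ k, J) ≅ J ^ k`. The right-hand term is `Hom(ker p, J)`, with `ker
    -- p` again finite as `R` is Noetherian, so the induction runs over all finite modules.
    have : Injective (homKerShortComplex p J).X₂ :=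
      injective_of_linearEquiv (LinearEquiv.piRing R J (Fin k) R).symm
    exact (extEventuallyZero_one_iff (homKerShortComplex_shortExact hp J)
      (extEventuallyZero_of_injective _)).2 (torsionLifts_homKerShortComplex_g p J)
  | succ n ih =>
    obtain ⟨k, p, hp⟩ := Module.Finite.exists_fin' R M
    have : Injective (homKerShortComplex p J).X₂ :=
      injective_of_linearEquiv (LinearEquiv.piRing R J (Fin k) R).symm
    exact ExtEventuallyZero.left (homKerShortComplex_shortExact hp J) (ih (LinearMap.ker p))
      (extEventuallyZero_of_injective _)

/-- If `Ext^j(M, K) = 0` for all `j > 0`, then `H_I^i(M, K) = 0` if and only if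
`H_I^i(Hom(M, K)) = 0`. -/
lemma extEventuallyZero_iff_hom [IsNoetherianRing R] (M : Type u) [AddCommGroup M] [Module R M]
    [Module.Finite R M] (i : ℕ) (K : ModuleCat.{u} R)
    (hK : ∀ j : ℕ, Subsingleton (Ext (ModuleCat.of R M) K (j + 1))) :
    ExtEventuallyZero I i M K ↔ ExtEventuallyZero I i R (ModuleCat.of R (M →ₗ[R] K)) := by
  cases i with
  | zero =>
    rw [extEventuallyZero_zero_iff, extEventuallyZero_zero_iff]
    let e := LinearMap.ringLmapEquivSelf R R (M →ₗ[R] K)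
    refine ⟨fun h f hf => ?_, fun h f hf => ?_⟩
    · exact e.map_eq_zero_iff.1 (h (e f) ((isPowTorsion_equiv_iff e).2 hf))
    · exact e.symm.map_eq_zero_iff.1 (h (e.symm f) ((isPowTorsion_equiv_iff e.symm).2 hf))
  | succ i =>
    induction i generalizing K with
    | zero =>
      let S := ShortComplex.mk (Injective.ι K) (Limits.cokernel.π (Injective.ι K)) (by simp)
      have hS : S.ShortExact := ⟨ShortComplex.exact_cokernel _⟩
      have hJ : Module.Injective R S.X₂ :=
        Module.injective_module_of_injective_object (inj := inferInstanceAs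
          (Injective (Injective.under K))) R S.X₂
      have hJ' : Injective S.X₂ := inferInstanceAs (Injective (Injective.under K))
      exact (extEventuallyZero_one_iff hS (extEventuallyZero_of_injective _)).trans
        ((torsionLifts_iff_compRight M _).trans
          (extEventuallyZero_one_iff (homShortComplex_shortExact hS (hK 0))
            (extEventuallyZero_hom_injective S.X₂ 0 M)).symm)
    | succ i ih =>
      let S := ShortComplex.mk (Injective.ι K) (Limits.cokernel.π (Injective.ι K)) (by simp)
      have hS : S.ShortExact := ⟨ShortComplex.exact_cokernel _⟩
      have hJ : Module.Injective R S.X₂ :=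
        Module.injective_module_of_injective_object (inj := inferInstanceAs
          (Injective (Injective.under K))) R S.X₂
      have hJ' : Injective S.X₂ := inferInstanceAs (Injective (Injective.under K))
      -- The hypothesis passes to the cokernel: `Ext^(j+1)(M, X₃)` sits between `Ext^(j+1)(M, X₂) =
      -- 0` and `Ext^(j+2)(M, K) = 0`.
      have hK' (j : ℕ) : Subsingleton (Ext (ModuleCat.of R M) S.X₃ (j + 1)) := by
        refine subsingleton_of_forall_eq 0 fun x => ?_
        have := hK (j + 1)
        obtain ⟨y, rfl⟩ := Ext.covariant_sequence_exact₃ _ hS x rfl (Subsingleton.elim _ _)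
        rw [Ext.eq_zero_of_injective y, Ext.zero_comp]
      exact (extEventuallyZero_left_iff hS (extEventuallyZero_of_injective _)
        (extEventuallyZero_of_injective _)).trans ((ih S.X₃ hK').trans
          (extEventuallyZero_left_iff (homShortComplex_shortExact hS (hK 0))
            (extEventuallyZero_hom_injective S.X₂ i M)
            (extEventuallyZero_hom_injective S.X₂ (i + 1) M)).symm)

lemma IsSemidualizing.extEventuallyZero_iff [IsNoetherianRing R] {C : Type u} [AddCommGroup C]
    [Module R C] (hC : IsSemidualizing R C) (i : ℕ) :
    ExtEventuallyZero I i C (ModuleCat.of R C) ↔ ExtEventuallyZero I i R (ModuleCat.of R R) := by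
  have := hC.finite
  rw [extEventuallyZero_iff_hom C i (ModuleCat.of R C) fun j => hC.ext_eq_zero _ j.succ_pos]
  let e := (LinearEquiv.ofBijective (LinearMap.lsmul R C) hC.homothety_bijective).toModuleIso
  exact ⟨.of_iso e.symm, .of_iso e⟩

end

/-! ### Grade and local cohomology of `R` -/

section Grade

variable {I : Ideal R}

lemma support_quotient_pow_subset (I : Ideal R) (q : ℕ) :
    Module.support R (R ⧸ (I ^ q • ⊤ : Submodule R R)) ⊆ PrimeSpectrum.zeroLocus I := by
  rw [Module.support_quotient]
  refine Set.inter_subset_right.trans ?_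
  rcases eq_or_ne q 0 with rfl | hq
  · simp
  · rw [PrimeSpectrum.zeroLocus_pow _ hq]

lemma smul_top_lt_top (hI : I ≠ ⊤) : I • (⊤ : Submodule R R) < ⊤ := by
  simpa using hI.lt_top

lemma natCast_le_depth_iff (n : ℕ) :
    ((n : ℕ∞) : WithBot ℕ∞) ≤ depth I R ↔
      ∀ i < n, ExtEventuallyZero I i R (ModuleCat.of R R) := by
  simp only [depth, depthPair, le_iInf_iff, nontrivial_genLocalCohomology_iff,
    WithBot.coe_le_coe, Nat.cast_le]
  exact forall_congr' fun i => by rw [← not_lt]; tauto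

variable [IsNoetherianRing R]

lemma extEventuallyZero_of_isRegular (hI : I ≠ ⊤) {rs : List R} (hrs : ∀ r ∈ rs, r ∈ I)
    (h : RingTheory.Sequence.IsRegular R rs) {i : ℕ} (hi : i < rs.length) :
    ExtEventuallyZero I i R (ModuleCat.of R R) :=
  .of_forall_subsingleton fun q => ModuleCat.subsingleton_ext_of_exists_isRegular I
    (ModuleCat.of R (R ⧸ (I ^ q • ⊤ : Submodule R R))) (support_quotient_pow_subset I q)
    (ModuleCat.of R R) (smul_top_lt_top hI) rs hrs h i hi

/-- If `I` contains an `R`-regular sequence of length `n`, then `H_I^n(R) = 0` forces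
`Ext^n(R / I ^ q, R) = 0`. -/
lemma subsingleton_ext_of_extEventuallyZero (hI : I ≠ ⊤) {rs : List R} (hrs : ∀ r ∈ rs, r ∈ I)
    (hreg : RingTheory.Sequence.IsRegular R rs)
    (h : ExtEventuallyZero I rs.length R (ModuleCat.of R R)) (q : ℕ) :
    Subsingleton (Ext (ModuleCat.of R (R ⧸ (I ^ q • ⊤ : Submodule R R))) (ModuleCat.of R R)
      rs.length) := by
  refine subsingleton_of_forall_eq 0 fun x => ?_
  obtain ⟨q', hq, hx⟩ := h q x
  have hsurj : Function.Surjective (powQuotMap I R hq) :=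
    Submodule.factor_surjective (Submodule.smul_mono_left (Ideal.pow_le_pow_right hq))
  have hS := LinearMap.shortExact_shortComplexKer hsurj
  generalize hn : rs.length = n at x hx
  cases n with
  | zero =>
    have := hS.epi_g
    refine Ext.precomp_mk₀_injective_of_epi _ (powQuotMap I R hq).shortComplexKer.g ?_
    exact hx.trans (map_zero _).symm
  | succ n =>
    -- The kernel of the transition map is supported in `V(I)`, so its `Ext^n` into `R` vanishes
    -- below the length `n + 1`. Hence the transition map on `Ext^(n+1)` is injective, and a class
    -- that dies later is already zero.
    obtain ⟨y, rfl⟩ := Ext.contravariant_sequence_exact₃ hS _ x hx (add_comm 1 n)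
    have hK : Module.support R (LinearMap.ker (powQuotMap I R hq)) ⊆ PrimeSpectrum.zeroLocus I :=
      (Module.support_subset_of_injective _ (Submodule.subtype_injective _)).trans
        (support_quotient_pow_subset I q')
    have := ModuleCat.subsingleton_ext_of_exists_isRegular I
      (ModuleCat.of R (LinearMap.ker (powQuotMap I R hq))) hK
      (ModuleCat.of R R) (smul_top_lt_top hI) rs hrs hreg n (by omega)
    rw [Subsingleton.elim y 0, Ext.comp_zero]

lemma exists_isRegular_of_extEventuallyZero (hI : I ≠ ⊤) (n : ℕ)
    (h : ∀ i < n, ExtEventuallyZero I i R (ModuleCat.of R R)) :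
    ∃ rs : List R, rs.length = n ∧ (∀ r ∈ rs, r ∈ I) ∧ RingTheory.Sequence.IsRegular R rs := by
  induction n with
  | zero =>
    have : Nontrivial R := (Submodule.nontrivial_iff R).1 (nontrivial_of_ne _ _ hI)
    exact ⟨[], rfl, by simp, .nil R R⟩
  | succ n ih =>
    obtain ⟨rs, rfl, hrs, hreg⟩ := ih fun i hi => h i (by omega)
    -- The converse criterion needs a test module with support all of `V(I)`; `q = 1`, that is `R /
    -- I`, serves. The sequence it gives is new and need not extend `rs`.
    have hsupp : Module.support R (R ⧸ (I ^ 1 • ⊤ : Submodule R R)) =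
        PrimeSpectrum.zeroLocus I := by
      rw [pow_one, smul_eq_mul, Ideal.mul_top, Module.support_eq_zeroLocus,
        Ideal.annihilator_quotient]
    refine ModuleCat.exists_isRegular_of_exists_subsingleton_ext I _ (ModuleCat.of R R)
      (smul_top_lt_top hI) (ModuleCat.of R (R ⧸ (I ^ 1 • ⊤ : Submodule R R))) hsupp
      fun i hi => ?_
    rcases Nat.lt_succ_iff_lt_or_eq.1 hi with hi | rfl
    · exact ModuleCat.subsingleton_ext_of_exists_isRegular I _ hsupp.subset _
        (smul_top_lt_top hI) rs hrs hreg i hi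
    · exact subsingleton_ext_of_extEventuallyZero hI hrs hreg (h _ hi) 1

lemma natCast_le_grade_iff (hI : I ≠ ⊤) (n : ℕ) :
    (n : ℕ∞) ≤ grade I ↔ ∀ i < n, ExtEventuallyZero I i R (ModuleCat.of R R) := by
  constructor
  · intro h i hi
    -- The strict inequality yields an actual sequence longer than `i`, so the supremum need not be
    -- attained.
    have hlt : (i : ℕ∞) < grade I := lt_of_lt_of_le (Nat.cast_lt.2 hi) h
    simp only [grade, lt_iSup_iff, Nat.cast_lt] at hlt
    obtain ⟨rs, ⟨hrs, hreg⟩, hlen⟩ := hlt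
    exact extEventuallyZero_of_isRegular hI hrs hreg hlen
  · intro h
    obtain ⟨rs, rfl, hrs, hreg⟩ := exists_isRegular_of_extEventuallyZero hI n h
    exact le_iSup₂_of_le rs ⟨hrs, hreg⟩ le_rfl

/-- The grade of a proper ideal is the least degree with non-zero local cohomology. -/
lemma grade_eq_depth (hI : I ≠ ⊤) : (grade I : WithBot ℕ∞) = depth I R := by
  have h0 : depth I R ≠ ⊥ := fun h => by
    have := (natCast_le_depth_iff (I := I) 0).2 (by simp)
    simp [h] at this
  obtain ⟨d, hd⟩ := WithBot.ne_bot_iff_exists.1 h0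
  rw [← hd]
  refine congrArg _ (ENat.eq_of_forall_natCast_le_iff fun n => ?_)
  rw [natCast_le_grade_iff hI, ← natCast_le_depth_iff, ← hd, WithBot.coe_le_coe]

end Grade

end RelCM

theorem corollary3p7 {R : Type u} [CommRing R] [IsNoetherianRing R] (I : Ideal R) (hI : I ≠ ⊤)
    (C : Type u) [AddCommGroup C] [Module R C] (hC : RelCM.IsSemidualizing R C) :
    RelCM.depthPair I C C = RelCM.depth I R ∧
    RelCM.cdPair I C C = RelCM.cd I R ∧
    (RelCM.IsRelCM I R ↔ RelCM.IsCMPair I C C) ∧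
    (RelCM.IsCohomologicallyCI I ↔ RelCM.IsCMPair I C C) := by
  have key (i : ℕ) : Nontrivial (RelCM.GenLocalCohomology I i C C) ↔
      Nontrivial (RelCM.GenLocalCohomology I i R R) := by
    rw [RelCM.nontrivial_genLocalCohomology_iff, RelCM.nontrivial_genLocalCohomology_iff,
      hC.extEventuallyZero_iff]
  have hdepth : RelCM.depthPair I C C = RelCM.depth I R := by
    simp only [RelCM.depth, RelCM.depthPair, key]
  have hcd : RelCM.cdPair I C C = RelCM.cd I R := by
    simp only [RelCM.cd, RelCM.cdPair, key]
  refine ⟨hdepth, hcd, ?_, ?_⟩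
  · rw [RelCM.IsRelCM, RelCM.IsCMPair, hdepth, hcd]
  · rw [RelCM.IsCohomologicallyCI, RelCM.IsCMPair, hdepth, hcd, RelCM.grade_eq_depth hI]
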